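/- Let $\Phi_m$ denote the cardinal B-spline of degree $m$ on the knots $0,1,\dots,m+1$: $\Phi_0=\mathbf 1_{[0,1)}$ and $\Phi_m(s)=\frac{s}{m}\Phi_{m-1}(s)+\frac{m+1-s}{m}\Phi_{m-1}(s-1)$ for $m\ge 1$. For an integer $m\ge 0$ and $\theta\in[-\pi,\pi]$ let $$M_m(\theta)=(2-2\cos\theta)^{m+1}\sum_{j\in\mathbb Z}\frac{1}{(\theta+2j\pi)^{2m+2}},$$ where the value at $\theta=0$ is understood as the limit for $\theta\to0$. For integers $0\le k\le p$ define $D_p^k:[-\pi,\pi]\to\mathbb R$ by $$D_p^k(\theta)=(-1)^k(2-2\cos\theta)^kM_{p-k}(\theta).$$ Then $M_0\equiv 1$, and for all integers $0\le k\le p$ the spline $\Phi_{2p+1}$ is of class $C^{2k}$ and, for every $\theta\in[-\pi,\pi]$, $$\partial_s^{2k}\Phi_{2p+1}(p+1)+\sum_{j=1}^{p}\partial_s^{2k}\Phi_{2p+1}(p+1-j)\,\bigl(e^{-\mathrm i j\theta}+e^{\mathrm i j\theta}\bigr)=D_p^k(\theta).$$ More explicitly, $$D_p^k(\theta)=(-1)^k(2-2\cos\theta)^{p+1}\sum_{j\in\mathbb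 Z}\frac{1}{(\theta+2j\pi)^{2(p+1-k)}},$$ with a convergent series for $\theta\ne0$, and with the right-hand side read as its limit for $\theta\to0$ at $\theta=0$. In particular, $D_p^0(0)=1$, $D_p^k(0)=0$ for $k\ge1$, and $$D_p^k(\pi)=(-1)^k2^{2k}M_{p-k}(\pi)=(-1)^k2^{2k+1}\,\frac{2^{2(p+1-k)}-1}{\pi^{2(p+1-k)}}\,\zeta\bigl(2(p+1-k)\bigr),$$ where $\zeta$ is the Riemann zeta function. -/

import Mathlib

open Filter Topology

noncomputable section

/-- The cardinal B-spline `Φ_p` of degree `p` on the knots `0, 1, …, p + 1`: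
`Φ_0` is the indicator function of `[0, 1)`, and for `p ≥ 1`
`Φ_p(s) = (s / p) Φ_{p-1}(s) + ((p + 1 - s) / p) Φ_{p-1}(s - 1)`. -/
def cardinalBSpline : ℕ → ℝ → ℝ
  | 0 => Set.indicator (Set.Ico (0 : ℝ) 1) (fun _ => 1)
  | p + 1 => fun s =>
      s / ((p + 1 : ℕ) : ℝ) * cardinalBSpline p s
        + (((p + 1 : ℕ) : ℝ) + 1 - s) / ((p + 1 : ℕ) : ℝ) * cardinalBSpline p (s - 1)

/-- The expression `(2 - 2 cos θ)^(p+1) ∑_{j ∈ ℤ} (θ + 2 j π)^(-(2p+2))`, meaningful at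
`θ ∈ [-π, π]`, `θ ≠ 0`. -/
def massSymbolExpr (p : ℕ) (θ : ℝ) : ℝ :=
  (2 - 2 * Real.cos θ) ^ (p + 1)
    * ∑' j : ℤ, 1 / (θ + 2 * (j : ℝ) * Real.pi) ^ (2 * p + 2)

open Classical in
/-- The function `M_p` on `[-π, π]`: given by `massSymbolExpr p` away from `0`, and extended to the
removable singularity `θ = 0` by the limit as `θ → 0`.
(Only the values on `[-π, π]` are meaningful.) -/
def massSymbol (p : ℕ) (θ : ℝ) : ℝ :=
  if θ = 0 then limUnder (𝓝[≠] (0 : ℝ)) (massSymbolExpr p) else massSymbolExpr p θ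

/-- The function `D_p^k(θ) = (-1)^k (2 - 2 cos θ)^k M_{p-k}(θ)` on `[-π, π]`, for `0 ≤ k ≤ p`. -/
def penaltySymbol (p k : ℕ) (θ : ℝ) : ℝ :=
  (-1) ^ k * (2 - 2 * Real.cos θ) ^ k * massSymbol (p - k) θ

end

/-!
The B-spline `Φ_n`, translated so that its support is centred at the origin, is the `(n + 1)`-fold
convolution power of the indicator function of `[-1/2, 1/2)`, so its Fourier transform is
`ξ ↦ sinc(πξ)^(n+1)`, and taking `2k` derivatives multiplies this by `(2πiξ)^(2k)`. Poisson
summation therefore turns the left-hand side of the symbol relation, at degree `2p + 1`, into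
`∑_j (-1)^k t_j^(2k) sinc(t_j / 2)^(2p+2)` with `t_j = θ + 2jπ`. Since
`(t sinc(t / 2))^2 = 2 - 2 cos t` is `2π`-periodic, this is `(-1)^k (2 - 2 cos θ)^k` times
`∑_j sinc(t_j / 2)^(2(p-k)+2)`, and applying the same identity to the remaining powers gives
`M_{p-k}(θ)`. At `θ = 0` only the term `j = 0` survives, and at `θ = π` the points `t_j` are the
odd multiples of `π`, over which the sum is the zeta value without its even terms.
-/

section

open Set Function MeasureTheory FourierTransform
open scoped Convolution Real

lemma cardinalBSpline_succ (p : ℕ) (s : ℝ) :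
    cardinalBSpline (p + 1) s = s / ((p : ℝ) + 1) * cardinalBSpline p s
        + ((p : ℝ) + 2 - s) / ((p : ℝ) + 1) * cardinalBSpline p (s - 1) := by
  simp only [cardinalBSpline]
  push_cast
  ring

lemma cardinalBSpline_zero_apply (s : ℝ) :
    cardinalBSpline 0 s = if 0 ≤ s ∧ s < 1 then 1 else 0 := by
  simp [cardinalBSpline, indicator_apply]

lemma cardinalBSpline_one_apply (s : ℝ) :
    cardinalBSpline 1 s = max 0 (min s (2 - s)) := by
  rw [cardinalBSpline_succ, cardinalBSpline_zero_apply, cardinalBSpline_zero_apply]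
  grind

lemma continuous_cardinalBSpline_succ (p : ℕ) : Continuous (cardinalBSpline (p + 1)) := by
  induction p with
  | zero =>
    rw [zero_add, funext cardinalBSpline_one_apply]
    fun_prop
  | succ p ih =>
    rw [funext (cardinalBSpline_succ (p + 1))]
    fun_prop

lemma support_cardinalBSpline_subset (p : ℕ) : support (cardinalBSpline p) ⊆ Ico 0 (p + 1) := by
  refine support_subset_iff'.2 fun s hs => ?_
  induction p generalizing s with
  | zero => simp_all [cardinalBSpline]
  | succ p ih =>
    rw [cardinalBSpline_succ, ih s, ih (s - 1)]
    · simp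
    all_goals grind

lemma cardinalBSpline_eq_zero_of_neg (p : ℕ) {s : ℝ} (hs : s < 0) : cardinalBSpline p s = 0 :=
  notMem_support.1 fun h => hs.not_ge (support_cardinalBSpline_subset p h).1

lemma cardinalBSpline_succ_reflect (p : ℕ) (s : ℝ) :
    cardinalBSpline (p + 1) ((p : ℝ) + 2 - s) = cardinalBSpline (p + 1) s := by
  induction p generalizing s with
  | zero =>
    rw [zero_add, cardinalBSpline_one_apply, cardinalBSpline_one_apply, min_comm]
    norm_num
  | succ p ih =>
    rw [cardinalBSpline_succ, cardinalBSpline_succ (p + 1) s, ← ih (s - 1), ← ih s]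
    push_cast
    ring_nf

lemma cardinalBSpline_succ_sub (p : ℕ) (s : ℝ) :
    ((p : ℝ) + 1) * (cardinalBSpline (p + 1) s - cardinalBSpline (p + 1) (s - 1))
      = s * cardinalBSpline p s + ((p : ℝ) + 3 - 2 * s) * cardinalBSpline p (s - 1)
        - ((p : ℝ) + 3 - s) * cardinalBSpline p (s - 1 - 1) := by
  rw [cardinalBSpline_succ, cardinalBSpline_succ]
  field_simp
  ring

lemma eventually_nhdsGT_le_iff {α : Type*} [LinearOrder α] [TopologicalSpace α]
    [ClosedIicTopology α] [ClosedIciTopology α] (a s : α) : ∀ᶠ t in 𝓝[>] s, a ≤ t ↔ a ≤ s := by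
  rcases lt_or_ge s a with h | h
  · filter_upwards [mem_nhdsWithin_of_mem_nhds (Iio_mem_nhds h)] with t ht
    exact iff_of_false ht.not_ge h.not_ge
  · filter_upwards [self_mem_nhdsWithin] with t ht
    exact iff_of_true (h.trans (mem_Ioi.1 ht).le) h

-- `Φ_0` jumps at `0` and `1` but is right-differentiable everywhere, so the derivative recursion
-- can start in degree `0` if only right derivatives are used.
lemma hasDerivWithinAt_cardinalBSpline_zero (s : ℝ) :
    HasDerivWithinAt (cardinalBSpline 0) 0 (Ioi s) s := by
  refine (hasDerivWithinAt_const s (Ioi s) (cardinalBSpline 0 s)).congr_of_eventuallyEq ?_ rfl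
  filter_upwards [eventually_nhdsGT_le_iff 0 s, eventually_nhdsGT_le_iff 1 s] with t h₀ h₁
  simp only [cardinalBSpline_zero_apply, ← not_le, h₀, h₁]

lemma hasDerivWithinAt_comp_sub_const_Ioi {E : Type*} [NormedAddCommGroup E] [NormedSpace ℝ E]
    {f : ℝ → E} {f' : E} {s a : ℝ}
    (h : HasDerivWithinAt f f' (Ioi (s - a)) (s - a)) :
    HasDerivWithinAt (fun t => f (t - a)) f' (Ioi s) s := by
  have := h.scomp s (((hasDerivAt_id s).sub_const a).hasDerivWithinAt (s := Ioi s))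
    (fun t ht => sub_lt_sub_right ht a)
  simpa [Function.comp_def] using this

lemma hasDerivWithinAt_cardinalBSpline_succ_of_hasDerivWithinAt {p : ℕ} {s a b : ℝ}
    (ha : HasDerivWithinAt (cardinalBSpline p) a (Ioi s) s)
    (hb : HasDerivWithinAt (cardinalBSpline p) b (Ioi (s - 1)) (s - 1)) :
    HasDerivWithinAt (cardinalBSpline (p + 1))
      ((cardinalBSpline p s - cardinalBSpline p (s - 1) + s * a + ((p : ℝ) + 2 - s) * b)
        / ((p : ℝ) + 1)) (Ioi s) s := by
  rw [funext (cardinalBSpline_succ p)]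
  have h₁ := (((hasDerivAt_id s).div_const ((p : ℝ) + 1)).hasDerivWithinAt (s := Ioi s)).mul ha
  have h₂ := ((((hasDerivAt_id s).const_sub ((p : ℝ) + 2)).div_const
    ((p : ℝ) + 1)).hasDerivWithinAt (s := Ioi s)).mul (hasDerivWithinAt_comp_sub_const_Ioi hb)
  refine (h₁.add h₂).congr_deriv ?_
  simp only [id]
  ring

lemma hasDerivWithinAt_cardinalBSpline_succ (p : ℕ) (s : ℝ) :
    HasDerivWithinAt (cardinalBSpline (p + 1))
      (cardinalBSpline p s - cardinalBSpline p (s - 1)) (Ioi s) s := by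
  induction p generalizing s with
  | zero =>
    refine (hasDerivWithinAt_cardinalBSpline_succ_of_hasDerivWithinAt
      (hasDerivWithinAt_cardinalBSpline_zero _)
      (hasDerivWithinAt_cardinalBSpline_zero _)).congr_deriv ?_
    simp
  | succ p ih =>
    refine (hasDerivWithinAt_cardinalBSpline_succ_of_hasDerivWithinAt
      (ih s) (ih (s - 1))).congr_deriv ?_
    push_cast
    rw [div_eq_iff (by positivity)]
    linear_combination -cardinalBSpline_succ_sub p s

lemma integrable_cardinalBSpline (n : ℕ) : Integrable (cardinalBSpline n) := by
  cases n with
  | zero => exact (integrable_indicator_iff measurableSet_Ico).2 (integrable_const 1)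
  | succ p =>
    refine (continuous_cardinalBSpline_succ p).integrable_of_hasCompactSupport ?_
    exact .of_support_subset_isCompact isCompact_Icc
      ((support_cardinalBSpline_subset _).trans Ico_subset_Icc_self)

lemma integral_cardinalBSpline_of_neg (n : ℕ) {a b : ℝ} (ha : a < 0) (hb : b < 0) :
    ∫ t in a..b, cardinalBSpline n t = 0 :=
  intervalIntegral.integral_zero_ae <| .of_forall fun _ ht =>
    cardinalBSpline_eq_zero_of_neg n (ht.2.trans_lt (max_lt ha hb))

lemma cardinalBSpline_succ_eq_integral (n : ℕ) (s : ℝ) :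
    cardinalBSpline (n + 1) s = ∫ t in (s - 1)..s, cardinalBSpline n t := by
  have hInt (a b : ℝ) : IntervalIntegrable (cardinalBSpline n) volume a b :=
    (integrable_cardinalBSpline n).intervalIntegrable
  have hInt' : IntervalIntegrable (fun t => cardinalBSpline n (t - 1)) volume (-1) s :=
    ((integrable_cardinalBSpline n).comp_sub_right 1).intervalIntegrable
  have hzero : cardinalBSpline (n + 1) (-1) = 0 :=
    cardinalBSpline_eq_zero_of_neg _ neg_one_lt_zero
  calc cardinalBSpline (n + 1) s
      = ∫ t in (-1)..s, (cardinalBSpline n t - cardinalBSpline n (t - 1)) := by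
        rw [intervalIntegral.integral_eq_sub_of_hasDeriv_right
          (continuous_cardinalBSpline_succ n).continuousOn
          (fun t _ => hasDerivWithinAt_cardinalBSpline_succ n t) ((hInt _ _).sub hInt'), hzero,
          sub_zero]
    _ = (∫ t in (-1)..s, cardinalBSpline n t) - ∫ t in (-1 - 1)..(s - 1), cardinalBSpline n t := by
        rw [intervalIntegral.integral_sub (hInt _ _) hInt',
          intervalIntegral.integral_comp_sub_right (cardinalBSpline n)]
    _ = ∫ t in (s - 1)..s, cardinalBSpline n t := by
        rw [intervalIntegral.integral_interval_sub_interval_comm (hInt _ _) (hInt _ _) (hInt _ _),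
          integral_cardinalBSpline_of_neg n neg_one_lt_zero (by norm_num), zero_sub,
          ← intervalIntegral.integral_symm]

lemma hasDerivAt_integral_sub_const {E : Type*} [NormedAddCommGroup E] [NormedSpace ℝ E]
    [CompleteSpace E] {f : ℝ → E} (hf : Continuous f) (a s : ℝ) :
    HasDerivAt (fun s => ∫ t in (s - a)..s, f t) (f s - f (s - a)) s := by
  have hInt (a b : ℝ) : IntervalIntegrable f volume a b := hf.intervalIntegrable a b
  have hF (x : ℝ) : HasDerivAt (fun u => ∫ t in (0)..u, f t) (f x) x :=
    hf.integral_hasStrictDerivAt 0 x |>.hasDerivAt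
  have hFF := (hF s).sub ((hF (s - a)).comp_sub_const s a)
  refine hFF.congr_of_eventuallyEq (.of_forall fun u => ?_)
  exact (intervalIntegral.integral_interval_sub_left (hInt _ _) (hInt _ _)).symm

lemma hasDerivAt_cardinalBSpline_add_two (p : ℕ) (s : ℝ) :
    HasDerivAt (cardinalBSpline (p + 2))
      (cardinalBSpline (p + 1) s - cardinalBSpline (p + 1) (s - 1)) s := by
  rw [funext (cardinalBSpline_succ_eq_integral (p + 1))]
  exact hasDerivAt_integral_sub_const (continuous_cardinalBSpline_succ p) 1 s

lemma contDiff_cardinalBSpline_succ (p : ℕ) : ContDiff ℝ p (cardinalBSpline (p + 1)) := by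
  induction p with
  | zero => exact contDiff_zero.2 (continuous_cardinalBSpline_succ 0)
  | succ p ih =>
    have hd := hasDerivAt_cardinalBSpline_add_two p
    rw [Nat.cast_succ, contDiff_succ_iff_deriv]
    refine ⟨fun s => (hd s).differentiableAt, by simp, ?_⟩
    rw [show deriv (cardinalBSpline (p + 2)) = _ from funext fun s => (hd s).deriv]
    exact ih.sub (ih.comp (contDiff_id.sub contDiff_const))

/-- The B-spline `Φ_n` translated so that its support is centred at the origin: its reflection
symmetry becomes evenness, and its Fourier transform a power of `sinc` without phase factor. -/
noncomputable def centeredBSpline (n : ℕ) (x : ℝ) : ℝ := cardinalBSpline n (x + (n + 1) / 2)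

lemma integrable_centeredBSpline (n : ℕ) : Integrable (centeredBSpline n) :=
  (integrable_cardinalBSpline n).comp_add_right _

lemma centeredBSpline_succ_neg (p : ℕ) (x : ℝ) :
    centeredBSpline (p + 1) (-x) = centeredBSpline (p + 1) x := by
  rw [centeredBSpline, centeredBSpline, ← cardinalBSpline_succ_reflect]
  push_cast
  ring_nf

lemma support_centeredBSpline_subset (n : ℕ) :
    support (centeredBSpline n) ⊆ Icc (-((n + 1) / 2)) ((n + 1) / 2) := fun x hx => by
  have := support_cardinalBSpline_subset n hx
  constructor <;> linarith [this.1, this.2]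

lemma contDiff_centeredBSpline_succ (p : ℕ) : ContDiff ℝ p (centeredBSpline (p + 1)) :=
  (contDiff_cardinalBSpline_succ p).comp (contDiff_id.add contDiff_const)

lemma iteratedDeriv_centeredBSpline (m n : ℕ) (x : ℝ) :
    iteratedDeriv m (centeredBSpline n) x = iteratedDeriv m (cardinalBSpline n) (x + (n + 1) / 2) :=
  congrFun (iteratedDeriv_comp_add_const m (cardinalBSpline n) _) x

lemma centeredBSpline_zero_eq_indicator :
    centeredBSpline 0 = indicator (Ico (-(1 / 2)) (1 / 2)) 1 := by
  ext t
  simp only [centeredBSpline, cardinalBSpline_zero_apply, indicator_apply, mem_Ico, Pi.one_apply]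
  grind

lemma centeredBSpline_zero_sub (x t : ℝ) :
    centeredBSpline 0 (x - t) = indicator (Ioc (x - 1 / 2) (x + 1 / 2)) 1 t := by
  simp only [centeredBSpline_zero_eq_indicator, indicator_apply, mem_Ico, mem_Ioc, Pi.one_apply]
  grind

lemma integral_centeredBSpline_mul_zero_sub (n : ℕ) (x : ℝ) :
    ∫ t, centeredBSpline n t * centeredBSpline 0 (x - t) = centeredBSpline (n + 1) x := by
  calc ∫ t, centeredBSpline n t * centeredBSpline 0 (x - t)
      = ∫ t in (x - 1 / 2)..(x + 1 / 2), centeredBSpline n t := by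
        simp_rw [centeredBSpline_zero_sub x, ← indicator_mul_right, Pi.one_apply,
          mul_one]
        rw [integral_indicator measurableSet_Ioc, intervalIntegral.integral_of_le (by linarith)]
    _ = centeredBSpline (n + 1) x := by
        simp only [centeredBSpline]
        rw [intervalIntegral.integral_comp_add_right (cardinalBSpline n),
          cardinalBSpline_succ_eq_integral]
        push_cast
        ring_nf

lemma integral_exp_mul_I_eq_sinc_half (c : ℝ) :
    ∫ x in (-(1 / 2))..(1 / 2 : ℝ), Complex.exp ((c * x : ℝ) * Complex.I)
      = (Real.sinc (c / 2) : ℂ) := by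
  rcases eq_or_ne c 0 with rfl | hc
  · norm_num
  have h := intervalIntegral.smul_integral_comp_mul_left (a := -(1 / 2)) (b := 1 / 2)
    (fun t : ℝ => Complex.exp (t * Complex.I)) c
  rw [mul_neg, mul_one_div, integral_exp_mul_I_eq_sinc, Complex.real_smul, Complex.ofReal_div,
    Complex.ofReal_ofNat, mul_div_cancel₀ _ two_ne_zero] at h
  exact mul_left_cancel₀ (Complex.ofReal_ne_zero.2 hc) h

lemma fourier_centeredBSpline_zero (ξ : ℝ) :
    𝓕 (fun x => (centeredBSpline 0 x : ℂ)) ξ = (Real.sinc (π * ξ) : ℂ) := by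
  have hintegrand (x : ℝ) :
      Complex.exp (↑(-2 * π * x * ξ) * Complex.I) • (centeredBSpline 0 x : ℂ)
        = indicator (Ico (-(1 / 2)) (1 / 2))
          (fun x : ℝ => Complex.exp (↑(-2 * π * ξ * x) * Complex.I)) x := by
    rw [centeredBSpline_zero_eq_indicator, mul_right_comm _ x]
    simp only [indicator_apply, Pi.one_apply]
    split_ifs <;> simp
  rw [Real.fourier_real_eq_integral_exp_smul, integral_congr_ae (.of_forall hintegrand),
    integral_indicator measurableSet_Ico, integral_Ico_eq_integral_Ioc,
    ← intervalIntegral.integral_of_le (by norm_num), integral_exp_mul_I_eq_sinc_half,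
    ← Real.sinc_neg]
  ring_nf

lemma fourier_centeredBSpline (n : ℕ) (ξ : ℝ) :
    𝓕 (fun x => (centeredBSpline n x : ℂ)) ξ = (Real.sinc (π * ξ) : ℂ) ^ (n + 1) := by
  induction n with
  | zero => rw [fourier_centeredBSpline_zero, zero_add, pow_one]
  | succ n ih =>
    have hconv : (fun x => (centeredBSpline n x : ℂ)) ⋆[ContinuousLinearMap.mul ℂ ℂ]
        (fun x => (centeredBSpline 0 x : ℂ)) = fun x => (centeredBSpline (n + 1) x : ℂ) := by
      ext x
      simp only [convolution_mul, ← integral_centeredBSpline_mul_zero_sub, ← Complex.ofReal_mul,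
        integral_complex_ofReal]
    calc 𝓕 (fun x => (centeredBSpline (n + 1) x : ℂ)) ξ
        = 𝓕 (fun x => (centeredBSpline n x : ℂ)) ξ * 𝓕 (fun x => (centeredBSpline 0 x : ℂ)) ξ := by
          rw [← hconv]
          exact Real.fourier_mul_convolution_eq (integrable_centeredBSpline n).ofReal
            (integrable_centeredBSpline 0).ofReal ξ
      _ = (Real.sinc (π * ξ) : ℂ) ^ (n + 1 + 1) := by
          rw [ih, fourier_centeredBSpline_zero, pow_succ _ (n + 1)]

lemma iteratedDeriv_ofReal_comp {n : ℕ} {f : ℝ → ℝ} (hf : ContDiff ℝ n f) (x : ℝ) :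
    iteratedDeriv n (fun y => (f y : ℂ)) x = ((iteratedDeriv n f x : ℝ) : ℂ) := by
  have h := Complex.ofRealCLM.iteratedFDeriv_comp_left hf.contDiffAt (x := x) le_rfl
  exact DFunLike.congr_fun h fun _ => 1

lemma iteratedDeriv_neg_of_even {E : Type*} [NormedAddCommGroup E] [NormedSpace ℝ E]
    {n : ℕ} {f : ℝ → E} (hf : ∀ x, f (-x) = f x) (hn : Even n) (x : ℝ) :
    iteratedDeriv n f (-x) = iteratedDeriv n f x := by
  have h := iteratedDeriv_comp_neg n f x
  rw [hn.neg_one_pow, one_smul, funext hf] at h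
  exact h.symm

lemma support_iteratedDeriv_subset {E : Type*} [NormedAddCommGroup E] [NormedSpace ℝ E]
    (n : ℕ) (f : ℝ → E) :
    support (iteratedDeriv n f) ⊆ tsupport f := fun x hx =>
  support_iteratedFDeriv_subset n fun h => hx <| by rw [iteratedDeriv, h]; rfl

lemma iteratedDeriv_eq_zero_of_notMem_Ioo {E : Type*} [NormedAddCommGroup E] [NormedSpace ℝ E]
    {n : ℕ} {f : ℝ → E} {a b x : ℝ} (hf : ContDiff ℝ n f) (hsupp : support f ⊆ Icc a b)
    (hx : x ∉ Ioo a b) : iteratedDeriv n f x = 0 := by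
  have hsub : support (iteratedDeriv n f) ⊆ Ioo a b := by
    rw [← interior_Icc]
    exact interior_maximal
      ((support_iteratedDeriv_subset n f).trans (closure_minimal hsupp isClosed_Icc))
      (hf.continuous_iteratedDeriv n le_rfl).isOpen_support
  exact notMem_support.1 fun h => hx (hsub h)

lemma hasCompactSupport_centeredBSpline (n : ℕ) : HasCompactSupport (centeredBSpline n) :=
  .of_support_subset_isCompact isCompact_Icc (support_centeredBSpline_subset n)

lemma hasCompactSupport_iteratedDeriv {E : Type*} [NormedAddCommGroup E] [NormedSpace ℝ E]
    {f : ℝ → E} (hf : HasCompactSupport f) (n : ℕ) :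
    HasCompactSupport (iteratedDeriv n f) :=
  .of_support_subset_isCompact hf (support_iteratedDeriv_subset n f)

lemma fourier_iteratedDeriv_of_hasCompactSupport {n : ℕ} {f : ℝ → ℝ} (hf : ContDiff ℝ n f)
    (hc : HasCompactSupport f) (ξ : ℝ) :
    𝓕 (fun x => ((iteratedDeriv n f x : ℝ) : ℂ)) ξ
      = (2 * π * Complex.I * ξ) ^ n * 𝓕 (fun x => (f x : ℂ)) ξ := by
  have hInt (m : ℕ) (hm : (m : ℕ∞) ≤ n) : Integrable (iteratedDeriv m fun x => (f x : ℂ)) := by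
    have hfm : ContDiff ℝ m f := hf.of_le (mod_cast hm)
    rw [funext (iteratedDeriv_ofReal_comp hfm)]
    exact ((hfm.continuous_iteratedDeriv m le_rfl).integrable_of_hasCompactSupport
      (hasCompactSupport_iteratedDeriv hc m)).ofReal
  rw [← funext (iteratedDeriv_ofReal_comp hf)]
  exact congrFun (Real.fourier_iteratedDeriv (N := n) (Complex.ofRealCLM.contDiff.comp hf) hInt
    le_rfl) ξ

lemma fourier_iteratedDeriv_centeredBSpline {m p : ℕ} (h : m ≤ p) (t : ℝ) :
    𝓕 (fun x => ((iteratedDeriv m (centeredBSpline (p + 1)) x : ℝ) : ℂ)) (t / (2 * π))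
      = (t * Complex.I) ^ m * (Real.sinc (t / 2) : ℂ) ^ (p + 2) := by
  have hpi : (π : ℂ) ≠ 0 := Complex.ofReal_ne_zero.2 Real.pi_ne_zero
  have harg : π * (t / (2 * π)) = t / 2 := by field_simp
  rw [fourier_iteratedDeriv_of_hasCompactSupport
    ((contDiff_centeredBSpline_succ p).of_le (mod_cast h)) (hasCompactSupport_centeredBSpline _),
    fourier_centeredBSpline, harg]
  push_cast
  field_simp

lemma isBigO_cocompact_of_hasCompactSupport {X E F : Type*} [TopologicalSpace X]
    [NormedAddCommGroup E] [NormedAddCommGroup F] {f : X → E} (hf : HasCompactSupport f)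
    (g : X → F) : f =O[cocompact X] g :=
  .of_bound 0 <| by
    filter_upwards [hf.compl_mem_cocompact] with x hx
    simp [image_eq_zero_of_notMem_tsupport hx]

lemma fourier_mul_exp (f : ℝ → ℂ) (θ ξ : ℝ) :
    𝓕 (fun x => f x * Complex.exp (-(x * θ * Complex.I))) ξ = 𝓕 f ((θ + 2 * ξ * π) / (2 * π)) := by
  rw [Real.fourier_real_eq_integral_exp_smul, Real.fourier_real_eq_integral_exp_smul]
  refine integral_congr_ae (.of_forall fun x => ?_)
  simp only [smul_eq_mul]
  rw [mul_left_comm, ← Complex.exp_add, mul_comm]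
  congr 2
  push_cast
  field_simp
  ring

lemma tsum_mul_exp_eq_tsum_fourier {f : ℝ → ℂ} {θ : ℝ} (hf : Continuous f)
    (hc : HasCompactSupport f)
    (hs : Summable fun j : ℤ => 𝓕 f ((θ + 2 * j * π) / (2 * π))) :
    ∑' j : ℤ, f j * Complex.exp (-(j * θ * Complex.I))
      = ∑' j : ℤ, 𝓕 f ((θ + 2 * j * π) / (2 * π)) := by
  have h := Real.tsum_eq_tsum_fourier_of_rpow_decay_of_summable
    (f := fun x => f x * Complex.exp (-(x * θ * Complex.I))) (by fun_prop) one_lt_two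
    (isBigO_cocompact_of_hasCompactSupport hc.mul_right _)
    (hs.congr fun j => (fourier_mul_exp f θ j).symm) 0
  simpa [fourier_mul_exp] using h

lemma tsum_int_mul_exp_of_even {c : ℤ → ℂ} {p : ℕ} (heven : ∀ j, c (-j) = c j)
    (hzero : ∀ j : ℤ, p < |j| → c j = 0) (θ : ℝ) :
    ∑' j : ℤ, c j * Complex.exp (-(j * θ * Complex.I))
      = c 0 + ∑ j ∈ Finset.Icc 1 p, c j * (Complex.exp (-(Complex.I * j * θ))
        + Complex.exp (Complex.I * j * θ)) := by
  set f : ℤ → ℂ := fun j => c j * Complex.exp (-(j * θ * Complex.I)) with hf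
  have hpair (j : ℕ) : f j + f (-j : ℤ)
      = c j * (Complex.exp (-(Complex.I * j * θ)) + Complex.exp (Complex.I * j * θ)) := by
    simp only [hf, heven, mul_add]
    push_cast
    ring_nf
  have hf0 : f 0 = c 0 := by
    simp only [hf, Int.cast_zero, zero_mul, neg_zero, Complex.exp_zero, mul_one]
  have hsummable : Summable f := summable_of_ne_finset_zero (s := Finset.Icc (-p : ℤ) p)
    fun j hj => mul_eq_zero_of_left (hzero j <|
      lt_of_not_ge fun h => hj (Finset.mem_Icc.2 (abs_le.1 h))) _
  have hfinite : ∑' j : ℕ, (f j + f (-j : ℤ))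
      = (f 0 + f 0) + ∑ j ∈ Finset.Icc 1 p, (f j + f (-j : ℤ)) := by
    have hnot : 0 ∉ Finset.Icc 1 p := fun h => absurd (Finset.mem_Icc.1 h).1 (by lia)
    rw [tsum_eq_sum (s := insert 0 (Finset.Icc 1 p)) fun j hj => ?_, Finset.sum_insert hnot]
    · simp only [Nat.cast_zero, neg_zero]
    · rw [Finset.mem_insert, Finset.mem_Icc] at hj
      rw [hpair, hzero j (by rw [Nat.abs_cast]; lia), zero_mul]
  rw [tsum_nat_add_neg hsummable, hf0, Finset.sum_congr rfl fun j _ => hpair j] at hfinite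
  linear_combination hfinite

lemma summable_one_div_add_two_mul_pi_pow {n : ℕ} (hn : 2 ≤ n) (θ : ℝ) :
    Summable fun j : ℤ => 1 / (θ + 2 * (j : ℝ) * π) ^ n := by
  have h := ((Real.summable_one_div_int_add_rpow (θ / (2 * π)) n).2 (mod_cast hn)).mul_left
    (1 / (2 * π) ^ n)
  refine .of_norm (h.congr fun j => ?_)
  rw [Real.rpow_natCast, one_div_mul_one_div, norm_div, norm_pow, norm_one, Real.norm_eq_abs,
    ← abs_of_pos Real.two_pi_pos, ← mul_pow, ← abs_mul, abs_of_pos Real.two_pi_pos]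
  congr 3
  field_simp
  ring

lemma mul_sinc_half (t : ℝ) : t * Real.sinc (t / 2) = 2 * Real.sin (t / 2) := by
  rcases eq_or_ne t 0 with rfl | ht
  · simp
  · rw [Real.sinc_of_ne_zero (by simpa using ht)]
    field_simp

lemma mul_sinc_half_sq (t : ℝ) : (t * Real.sinc (t / 2)) ^ 2 = 2 - 2 * Real.cos t := by
  rw [mul_sinc_half, mul_pow, Real.sin_sq_eq_half_sub, mul_div_cancel₀ t two_ne_zero]
  ring

lemma norm_sinc_half_pow_le (n : ℕ) {t : ℝ} (ht : t ≠ 0) :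
    ‖Real.sinc (t / 2) ^ n‖ ≤ 2 ^ n * ‖1 / t ^ n‖ := by
  have h : ‖t * Real.sinc (t / 2)‖ ≤ 2 := by
    rw [mul_sinc_half, norm_mul, Real.norm_ofNat]
    exact mul_le_of_le_one_right zero_le_two (Real.abs_sin_le_one _)
  have h' := pow_le_pow_left₀ (norm_nonneg _) h n
  rw [norm_div, norm_one, norm_pow, norm_pow, mul_one_div, le_div_iff₀ (by positivity), ← mul_pow,
    mul_comm, ← norm_mul]
  exact h'

lemma injective_add_two_mul_pi (θ : ℝ) :
    Injective fun j : ℤ => θ + 2 * (j : ℝ) * π := fun i j h => by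
  have := Real.pi_ne_zero
  simpa [this] using h

lemma summable_sinc_half_pow {n : ℕ} (hn : 2 ≤ n) (θ : ℝ) :
    Summable fun j : ℤ => Real.sinc ((θ + 2 * j * π) / 2) ^ n := by
  have hne : ∀ᶠ j : ℤ in cofinite, θ + 2 * (j : ℝ) * π ≠ 0 :=
    (injective_add_two_mul_pi θ).tendsto_cofinite (eventually_cofinite_ne 0)
  exact ((summable_one_div_add_two_mul_pi_pow hn θ).norm.mul_left (2 ^ n))
    |>.of_norm_bounded_eventually (hne.mono fun j hj => norm_sinc_half_pow_le n hj)

/-- The lattice sum `∑_{j ∈ ℤ} sinc((θ + 2jπ) / 2)^(2m+2)`. It agrees with `massSymbolExpr m θ`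
where the latter is meaningful, and fills in its removable singularities `θ ∈ 2πℤ`. -/
noncomputable def sincLatticeSum (m : ℕ) (θ : ℝ) : ℝ :=
  ∑' j : ℤ, Real.sinc ((θ + 2 * j * π) / 2) ^ (2 * m + 2)

lemma sincLatticeSum_zero_right (m : ℕ) : sincLatticeSum m 0 = 1 := by
  rw [sincLatticeSum, tsum_eq_single 0 fun j hj => ?_]
  · simp
  have harg : (0 + 2 * (j : ℝ) * π) / 2 = j * π := by ring
  have hne : (j : ℝ) * π ≠ 0 := mul_ne_zero (Int.cast_ne_zero.2 hj) Real.pi_ne_zero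
  rw [harg, Real.sinc_of_ne_zero hne, Real.sin_int_mul_pi, zero_div, zero_pow (by lia)]

lemma cos_add_two_mul_int_mul_pi (θ : ℝ) (j : ℤ) : Real.cos (θ + 2 * j * π) = Real.cos θ := by
  rw [mul_comm 2 (j : ℝ), mul_assoc, Real.cos_add_int_mul_two_pi]

lemma massSymbolExpr_eq_sincLatticeSum (m : ℕ) {θ : ℝ} (hθ : Real.cos θ ≠ 1) :
    massSymbolExpr m θ = sincLatticeSum m θ := by
  rw [massSymbolExpr, sincLatticeSum, ← tsum_mul_left]
  refine tsum_congr fun j => ?_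
  have hne : θ + 2 * (j : ℝ) * π ≠ 0 := fun h => hθ <| by
    rw [← cos_add_two_mul_int_mul_pi θ j, h, Real.cos_zero]
  rw [← cos_add_two_mul_int_mul_pi θ j, ← mul_sinc_half_sq, ← pow_mul, mul_pow]
  field_simp
  ring

lemma fourier_iteratedDeriv_centeredBSpline_even {p k : ℕ} (hk : k ≤ p) (t : ℝ) :
    𝓕 (fun x => ((iteratedDeriv (2 * k) (centeredBSpline (2 * p + 1)) x : ℝ) : ℂ)) (t / (2 * π))
      = (((-1) ^ k * (2 - 2 * Real.cos t) ^ k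
          * Real.sinc (t / 2) ^ (2 * (p - k) + 2) : ℝ) : ℂ) := by
  have hexp : 2 * p + 2 = 2 * k + (2 * (p - k) + 2) := by lia
  rw [fourier_iteratedDeriv_centeredBSpline (by lia), ← mul_sinc_half_sq, ← pow_mul, hexp, pow_add,
    mul_pow, pow_mul Complex.I, Complex.I_sq]
  push_cast
  ring

lemma tsum_iteratedDeriv_centeredBSpline_mul_exp {p k : ℕ} (hk : k ≤ p) (θ : ℝ) :
    ∑' j : ℤ, ((iteratedDeriv (2 * k) (centeredBSpline (2 * p + 1)) j : ℝ) : ℂ)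
        * Complex.exp (-(j * θ * Complex.I))
      = (((-1) ^ k * (2 - 2 * Real.cos θ) ^ k * sincLatticeSum (p - k) θ : ℝ) : ℂ) := by
  have hfourier (j : ℤ) :
      𝓕 (fun x => ((iteratedDeriv (2 * k) (centeredBSpline (2 * p + 1)) x : ℝ) : ℂ))
          ((θ + 2 * j * π) / (2 * π))
        = (((-1) ^ k * (2 - 2 * Real.cos θ) ^ k
          * Real.sinc ((θ + 2 * j * π) / 2) ^ (2 * (p - k) + 2) : ℝ) : ℂ) := by
    rw [fourier_iteratedDeriv_centeredBSpline_even hk, cos_add_two_mul_int_mul_pi]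
  have hcont : Continuous (iteratedDeriv (2 * k) (centeredBSpline (2 * p + 1))) :=
    (contDiff_centeredBSpline_succ (2 * p)).continuous_iteratedDeriv _ (mod_cast (by lia))
  have hpoisson := tsum_mul_exp_eq_tsum_fourier (θ := θ) (Complex.continuous_ofReal.comp hcont)
    ((hasCompactSupport_iteratedDeriv (hasCompactSupport_centeredBSpline _) _).comp_left
      Complex.ofReal_zero)
    (((Complex.summable_ofReal.2 ((summable_sinc_half_pow (by lia) θ).mul_left _))).congr
      fun j => (hfourier j).symm)
  rw [sincLatticeSum, ← tsum_mul_left, Complex.ofReal_tsum, ← tsum_congr hfourier]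
  exact hpoisson

lemma cardinalBSpline_symbol_eq_sincLatticeSum {p k : ℕ} (hk : k ≤ p) (θ : ℝ) :
    ((iteratedDeriv (2 * k) (cardinalBSpline (2 * p + 1)) ((p : ℝ) + 1) : ℝ) : ℂ)
        + ∑ j ∈ Finset.Icc 1 p,
            ((iteratedDeriv (2 * k) (cardinalBSpline (2 * p + 1)) ((p : ℝ) + 1 - (j : ℝ)) : ℝ) : ℂ)
              * (Complex.exp (-(Complex.I * (j : ℂ) * (θ : ℂ)))
                + Complex.exp (Complex.I * (j : ℂ) * (θ : ℂ)))
      = (((-1) ^ k * (2 - 2 * Real.cos θ) ^ k * sincLatticeSum (p - k) θ : ℝ) : ℂ) := by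
  set g := iteratedDeriv (2 * k) (centeredBSpline (2 * p + 1)) with hg
  have hshift (x : ℝ) :
      iteratedDeriv (2 * k) (cardinalBSpline (2 * p + 1)) ((p : ℝ) + 1 - x) = g (-x) := by
    rw [hg, iteratedDeriv_centeredBSpline]
    push_cast
    ring_nf
  have heven (x : ℝ) : g (-x) = g x :=
    iteratedDeriv_neg_of_even (centeredBSpline_succ_neg (2 * p)) (even_two_mul k) x
  have hzero (j : ℤ) (hj : p < |j|) : g j = 0 := by
    refine iteratedDeriv_eq_zero_of_notMem_Ioo
      ((contDiff_centeredBSpline_succ (2 * p)).of_le (mod_cast (by lia)))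
      (support_centeredBSpline_subset _) fun h => ?_
    have hj' : (p : ℝ) + 1 ≤ |(j : ℝ)| := mod_cast hj
    have := abs_lt.2 h
    push_cast at this
    linarith
  have hsum := tsum_int_mul_exp_of_even (c := fun j => ((g j : ℝ) : ℂ)) (p := p)
    (fun j => by rw [Int.cast_neg, heven]) (fun j hj => by rw [hzero j hj, Complex.ofReal_zero]) θ
  rw [hg, tsum_iteratedDeriv_centeredBSpline_mul_exp hk, ← hg] at hsum
  have h0 := hshift 0
  rw [sub_zero] at h0
  simp only [hshift, heven, h0, hsum, Int.cast_zero, Int.cast_natCast, neg_zero]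

-- For `k = 0` the symbol identity exhibits the lattice sum as a trigonometric polynomial.
lemma continuous_sincLatticeSum (m : ℕ) : Continuous (sincLatticeSum m) := by
  have h : (fun θ => (sincLatticeSum m θ : ℂ)) = _ := funext fun θ => by
    have := (cardinalBSpline_symbol_eq_sincLatticeSum (Nat.zero_le m) θ).symm
    simpa using this
  have hc : Continuous fun θ => (sincLatticeSum m θ : ℂ) := by
    rw [h]
    fun_prop
  exact Complex.continuous_re.comp hc

lemma sincLatticeSum_zero_left (θ : ℝ) : sincLatticeSum 0 θ = 1 := by
  have h := cardinalBSpline_symbol_eq_sincLatticeSum (le_refl 0) θ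
  have h1 : cardinalBSpline 1 1 = 1 := by norm_num [cardinalBSpline_one_apply]
  simpa [h1] using h.symm

lemma cos_ne_one_of_mem_Ioo {θ : ℝ} (hθ : θ ∈ Ioo (-(2 * π)) (2 * π)) (h0 : θ ≠ 0) :
    Real.cos θ ≠ 1 :=
  (Real.cos_eq_one_iff_of_lt_of_lt hθ.1 hθ.2).not.2 h0

lemma tendsto_massSymbolExpr (m : ℕ) : Tendsto (massSymbolExpr m) (𝓝[≠] 0) (𝓝 1) := by
  have h := (continuous_sincLatticeSum m).tendsto 0
  rw [sincLatticeSum_zero_right] at h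
  refine (h.mono_left nhdsWithin_le_nhds).congr' ?_
  have hmem : Ioo (-(2 * π)) (2 * π) ∈ 𝓝 (0 : ℝ) :=
    Ioo_mem_nhds (neg_neg_of_pos Real.two_pi_pos) Real.two_pi_pos
  filter_upwards [mem_nhdsWithin_of_mem_nhds hmem, self_mem_nhdsWithin] with θ hθ h0
  exact (massSymbolExpr_eq_sincLatticeSum m (cos_ne_one_of_mem_Ioo hθ h0)).symm

lemma massSymbol_zero_right (m : ℕ) : massSymbol m 0 = 1 := by
  rw [massSymbol, if_pos rfl]
  exact (tendsto_massSymbolExpr m).limUnder_eq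

lemma massSymbol_of_ne_zero (m : ℕ) {θ : ℝ} (h0 : θ ≠ 0) : massSymbol m θ = massSymbolExpr m θ :=
  if_neg h0

lemma massSymbol_eq_sincLatticeSum (m : ℕ) {θ : ℝ} (hθ : θ ∈ Ioo (-(2 * π)) (2 * π)) :
    massSymbol m θ = sincLatticeSum m θ := by
  rcases eq_or_ne θ 0 with rfl | h0
  · rw [massSymbol_zero_right, sincLatticeSum_zero_right]
  · rw [massSymbol_of_ne_zero m h0,
      massSymbolExpr_eq_sincLatticeSum m (cos_ne_one_of_mem_Ioo hθ h0)]

lemma mul_tsum_one_div_pow_eq_mul_massSymbolExpr {p k : ℕ} (hk : k ≤ p) (θ : ℝ) :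
    (-1) ^ k * (2 - 2 * Real.cos θ) ^ (p + 1)
        * ∑' j : ℤ, 1 / (θ + 2 * (j : ℝ) * π) ^ (2 * (p + 1 - k))
      = (-1) ^ k * (2 - 2 * Real.cos θ) ^ k * massSymbolExpr (p - k) θ := by
  have hexp : 2 * (p + 1 - k) = 2 * (p - k) + 2 := by lia
  have hpow : p + 1 = k + (p - k + 1) := by lia
  rw [massSymbolExpr, hexp, hpow, pow_add]
  ring

lemma penaltySymbol_zero_right (p k : ℕ) : penaltySymbol p k 0 = 0 ^ k := by
  rw [penaltySymbol, massSymbol_zero_right]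
  cases k <;> simp

lemma tendsto_mul_tsum_one_div_pow {p k : ℕ} (hk : k ≤ p) :
    Tendsto (fun θ : ℝ => (-1) ^ k * (2 - 2 * Real.cos θ) ^ (p + 1)
        * ∑' j : ℤ, 1 / (θ + 2 * (j : ℝ) * π) ^ (2 * (p + 1 - k)))
      (𝓝[≠] 0) (𝓝 (penaltySymbol p k 0)) := by
  simp only [mul_tsum_one_div_pow_eq_mul_massSymbolExpr hk]
  rw [penaltySymbol, massSymbol_zero_right]
  have hc : Continuous fun θ : ℝ => (-1 : ℝ) ^ k * (2 - 2 * Real.cos θ) ^ k := by fun_prop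
  exact ((hc.tendsto 0).mono_left nhdsWithin_le_nhds).mul (tendsto_massSymbolExpr (p - k))

lemma tsum_int_even_add_odd {G : Type*} [AddCommGroup G] [UniformSpace G] [IsUniformAddGroup G]
    [CompleteSpace G] [T2Space G] {f : ℤ → G} (hf : Summable f) :
    ∑' j : ℤ, f (2 * j) + ∑' j : ℤ, f (2 * j + 1) = ∑' j : ℤ, f j := by
  have heven : Injective fun j : ℤ => 2 * j := mul_right_injective₀ two_ne_zero
  have hodd : Injective fun j : ℤ => 2 * j + 1 := (add_left_injective 1).comp heven
  have h := (heven.hasSum_range_iff.2 (hf.comp_injective heven).hasSum).add_isCompl ?_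
    (hodd.hasSum_range_iff.2 (hf.comp_injective hodd).hasSum)
  · exact h.tsum_eq.symm
  · simpa [Function.comp_def] using Int.isCompl_even_odd

lemma tsum_int_inv_odd_pow {n : ℕ} (hn : 2 ≤ n) (he : Even n) :
    ∑' j : ℤ, ((2 * (j : ℂ) + 1) ^ n)⁻¹ = 2 * (1 - 1 / 2 ^ n) * riemannZeta n := by
  have hs : Summable fun j : ℤ => ((j : ℂ) ^ n)⁻¹ := by
    simpa using Complex.summable_ofReal.2 (Real.summable_one_div_int_pow.2 (show 1 < n by lia))
  have h := tsum_int_even_add_odd hs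
  push_cast at h
  simp only [mul_pow, mul_inv] at h
  rw [tsum_mul_left, ← two_mul_riemannZeta_eq_tsum_int_inv_pow_of_even hn he] at h
  rw [eq_sub_of_add_eq' h]
  ring

lemma massSymbol_pi (m : ℕ) :
    (massSymbol m π : ℂ) = 2 * ((2 ^ (2 * m + 2) - 1) / (π : ℂ) ^ (2 * m + 2))
      * riemannZeta ((2 * m + 2 : ℕ) : ℂ) := by
  have hterm (j : ℤ) : ((1 / (π + 2 * (j : ℝ) * π) ^ (2 * m + 2) : ℝ) : ℂ)
      = 1 / (π : ℂ) ^ (2 * m + 2) * ((2 * (j : ℂ) + 1) ^ (2 * m + 2))⁻¹ := by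
    rw [← one_div, one_div_mul_one_div, ← mul_pow]
    push_cast
    ring_nf
  have hfour : (2 - 2 * Real.cos π) ^ (m + 1) = 2 ^ (2 * m + 2) := by
    rw [Real.cos_pi, show 2 * m + 2 = 2 * (m + 1) by ring, pow_mul]
    norm_num
  rw [massSymbol_of_ne_zero m Real.pi_ne_zero, massSymbolExpr, hfour, Complex.ofReal_mul,
    Complex.ofReal_tsum, tsum_congr hterm, tsum_mul_left,
    tsum_int_inv_odd_pow (by lia) ⟨m + 1, by ring⟩]
  push_cast
  field_simp

lemma penaltySymbol_pi (p k : ℕ) :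
    penaltySymbol p k π = (-1) ^ k * 2 ^ (2 * k) * massSymbol (p - k) π := by
  rw [penaltySymbol, Real.cos_pi, pow_mul]
  norm_num

end

theorem proposition6p2 (p k : ℕ) (hk : k ≤ p) :
    -- the derivatives of order `2k` of `Φ_{2p+1}` are classical
    ContDiff ℝ ((2 * k : ℕ) : ℕ∞) (cardinalBSpline (2 * p + 1)) ∧
    -- the relation for the symbol on `[-π, π]`
    (∀ θ ∈ Set.Icc (-Real.pi) Real.pi,
      ((iteratedDeriv (2 * k) (cardinalBSpline (2 * p + 1)) ((p : ℝ) + 1) : ℝ) : ℂ)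
        + ∑ j ∈ Finset.Icc 1 p,
            ((iteratedDeriv (2 * k) (cardinalBSpline (2 * p + 1)) ((p : ℝ) + 1 - (j : ℝ)) : ℝ) : ℂ)
              * (Complex.exp (-(Complex.I * (j : ℂ) * (θ : ℂ)))
                + Complex.exp (Complex.I * (j : ℂ) * (θ : ℂ)))
        = ((penaltySymbol p k θ : ℝ) : ℂ)) ∧
    -- `M_0` is identically `1`
    (∀ θ ∈ Set.Icc (-Real.pi) Real.pi, massSymbol 0 θ = 1) ∧
    -- the explicit form of `D_p^k`, with convergence of the series
    (∀ θ ∈ Set.Icc (-Real.pi) Real.pi, θ ≠ 0 →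
      Summable (fun j : ℤ => 1 / (θ + 2 * (j : ℝ) * Real.pi) ^ (2 * (p + 1 - k))) ∧
      penaltySymbol p k θ
        = (-1) ^ k * (2 - 2 * Real.cos θ) ^ (p + 1)
          * ∑' j : ℤ, 1 / (θ + 2 * (j : ℝ) * Real.pi) ^ (2 * (p + 1 - k))) ∧
    -- at `θ = 0` the explicit form is to be read as a limit
    Filter.Tendsto
      (fun θ : ℝ => (-1) ^ k * (2 - 2 * Real.cos θ) ^ (p + 1)
          * ∑' j : ℤ, 1 / (θ + 2 * (j : ℝ) * Real.pi) ^ (2 * (p + 1 - k)))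
      (nhdsWithin (0 : ℝ) {0}ᶜ) (nhds (penaltySymbol p k 0)) ∧
    -- the values at `0`
    penaltySymbol p 0 0 = 1 ∧
    (1 ≤ k → penaltySymbol p k 0 = 0) ∧
    -- the value at `π`
    penaltySymbol p k Real.pi = (-1) ^ k * 2 ^ (2 * k) * massSymbol (p - k) Real.pi ∧
    ((penaltySymbol p k Real.pi : ℝ) : ℂ)
      = (-1) ^ k * 2 ^ (2 * k + 1)
        * ((2 ^ (2 * (p + 1 - k)) - 1) / (Real.pi : ℂ) ^ (2 * (p + 1 - k)))
        * riemannZeta ((2 * (p + 1 - k) : ℕ) : ℂ) := by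
  have hexp : 2 * (p + 1 - k) = 2 * (p - k) + 2 := by lia
  have hIoo : Set.Icc (-Real.pi) Real.pi ⊆ Set.Ioo (-(2 * Real.pi)) (2 * Real.pi) :=
    Set.Icc_subset_Ioo (by linarith [Real.pi_pos]) (by linarith [Real.pi_pos])
  refine ⟨?_, fun θ hθ => ?_, fun θ hθ => ?_, fun θ _ h0 => ⟨?_, ?_⟩,
    tendsto_mul_tsum_one_div_pow hk, ?_, fun h => ?_, penaltySymbol_pi p k, ?_⟩
  · exact (contDiff_cardinalBSpline_succ (2 * p)).of_le (Nat.cast_le.2 (Nat.mul_le_mul_left 2 hk))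
  · rw [cardinalBSpline_symbol_eq_sincLatticeSum hk, penaltySymbol,
      massSymbol_eq_sincLatticeSum _ (hIoo hθ)]
  · rw [massSymbol_eq_sincLatticeSum 0 (hIoo hθ), sincLatticeSum_zero_left]
  · exact summable_one_div_add_two_mul_pi_pow (by lia) θ
  · rw [mul_tsum_one_div_pow_eq_mul_massSymbolExpr hk, penaltySymbol, massSymbol_of_ne_zero _ h0]
  · rw [penaltySymbol_zero_right, pow_zero]
  · rw [penaltySymbol_zero_right, zero_pow (by lia)]
  · rw [penaltySymbol_pi, Complex.ofReal_mul, massSymbol_pi, hexp]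
    push_cast
    ring
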